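/- Let $\mathcal Z$ be a search problem over a finite set $\mathcal D$ of probability distributions on a domain $X$ with solution set $\mathcal F$: every $D\in\mathcal D$ has a non-empty set $\mathcal Z(D)\subseteq\mathcal F$ of valid solutions. For $\tau>0$, the oracle $\mathrm{STAT}_D(\tau)$ answers a query $\phi:X\to[-1,1]$ with any value $v$ such that $|v-\mathbb E_{x\sim D}[\phi(x)]|\le\tau$. Let $\mathrm{QC}(\mathcal Z,\mathrm{STAT}(\tau))$ be the smallest $q$ for which there is a deterministic adaptive algorithm that, for every $D\in\mathcal D$ and all legal answers of $\mathrm{STAT}_D(\tau)$, asks at most $q$ queries and outputs an element of $\mathcal Z(D)$. Let $$R_{\mathrm{KL}}(\mathcal D)=\inf_{D_1}\ \sup_{D\in\mathcal D}\mathrm{KL}(D\,\|\,D_1),$$ where $D_1$ ranges over all probability distributions on $X$. A streaming algorithm with $b$ bits of memory has a state in $\{0,1\}^b$ with a fixed initial value; it replaces the state after each sample by a fixed deterministic function of the state and the sample, and its output is a function of the final state only. **Theorem.** There is an absolute constant $C>0$ such that the following holds. Let $0<\tau\le 1$, $0<\delta<1$, let $q\ge 2$ be an integer, and suppose that $\mathrm{QC}(\mathcal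 Z,\mathrm{STAT}(\tau))\le q$. Then there is a streaming algorithm that, for every $D\in\mathcal D$, outputs an element of $\mathcal Z(D)$ with probability at least $1-\delta$ over $n$ i.i.d. samples from $D$, where $$n\le C\cdot\frac{q\,R_{\mathrm{KL}}(\mathcal D)}{\tau^4}\cdot\log\frac{q}{\tau\delta},$$ and which uses $b$ bits of memory, where $$b\le C\left(\frac{R_{\mathrm{KL}}(\mathcal D)}{\tau^2}\cdot\log q+\log\frac{1+\log(1/\delta)}{\tau}\right).$$ -/

import Mathlib

open MeasureTheory

universe u v

/-- A distributional search problem over a set `dists` of probability distributions on `X`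
and a type `F` of solutions: every distribution of the class has a nonempty set of valid
solutions. -/
structure SearchProblem (X : Type u) [MeasurableSpace X] (F : Type v) where
  dists : Set (ProbabilityMeasure X)
  valid : dists → Set F
  valid_nonempty : ∀ D : dists, (valid D).Nonempty

/-- A statistical query: a (measurable) function `X → [-1, 1]`. -/
structure StatQuery (X : Type u) [MeasurableSpace X] where
  toFun : X → ℝ
  measurable_toFun : Measurable toFun
  mem_Icc : ∀ x, toFun x ∈ Set.Icc (-1 : ℝ) 1

/-- The expectation `D[φ]`. -/
noncomputable def StatQuery.mean {X : Type u} [MeasurableSpace X]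
    (φ : StatQuery X) (D : ProbabilityMeasure X) : ℝ :=
  ∫ x, φ.toFun x ∂(D : Measure X)

/-- A deterministic, adaptive statistical query algorithm: it either stops with a solution, or
asks a query and continues in a way that depends on the real number returned by the oracle. -/
inductive SQAlgorithm (X : Type u) [MeasurableSpace X] (F : Type v) : Type (max u v) where
  | output (f : F) : SQAlgorithm X F
  | query (φ : StatQuery X) (next : ℝ → SQAlgorithm X F) : SQAlgorithm X F

/-- `SQAlgorithm.Outcome D τ A k f`: there are responses, each of them within `τ` of the true
expectation under `D` (i.e. legal responses of `STAT_D(τ)`), for which `A` asks exactly `k`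
queries and then outputs `f`. -/
inductive SQAlgorithm.Outcome {X : Type u} [MeasurableSpace X] {F : Type v}
    (D : ProbabilityMeasure X) (τ : ℝ) : SQAlgorithm X F → ℕ → F → Prop where
  | output (f : F) : SQAlgorithm.Outcome D τ (SQAlgorithm.output f) 0 f
  | query (φ : StatQuery X) (next : ℝ → SQAlgorithm X F) (v : ℝ) (k : ℕ) (f : F)
      (hv : |v - φ.mean D| ≤ τ) (h : SQAlgorithm.Outcome D τ (next v) k f) :
      SQAlgorithm.Outcome D τ (SQAlgorithm.query φ next) (k + 1) f

/-- `A` solves `Z` with at most `q` queries to `STAT(τ)`: for every input distribution of the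
class and all legal responses of the oracle, it asks at most `q` queries and outputs a valid
solution. -/
def SQAlgorithm.Solves {X : Type u} [MeasurableSpace X] {F : Type v}
    (A : SQAlgorithm X F) (Z : SearchProblem X F) (τ : ℝ) (q : ℕ) : Prop :=
  ∀ (D : Z.dists) (k : ℕ) (f : F),
    SQAlgorithm.Outcome (D : ProbabilityMeasure X) τ A k f → k ≤ q ∧ f ∈ Z.valid D

/-- The deterministic SQ complexity `QC(Z, STAT(τ))` (it is `⊤` if no algorithm solves `Z` with a
bounded number of queries). -/
noncomputable def sqComplexity {X : Type u} [MeasurableSpace X] {F : Type v}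
    (Z : SearchProblem X F) (τ : ℝ) : ℕ∞ :=
  sInf {c : ℕ∞ | ∃ q : ℕ, c = (q : ℕ∞) ∧ ∃ A : SQAlgorithm X F, A.Solves Z τ q}

/-- The KL-radius `inf_{D₁} sup_{D ∈ 𝒟} KL(D ‖ D₁)`, where `D₁` ranges over all probability
distributions on `X`. For a finite nonempty class it is at most `log |𝒟|`, hence finite. -/
noncomputable def klRadius {X : Type u} [MeasurableSpace X]
    (𝒟 : Set (ProbabilityMeasure X)) : ENNReal :=
  ⨅ D₁ : ProbabilityMeasure X, ⨆ D ∈ 𝒟,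
    InformationTheory.klDiv (D : Measure X) (D₁ : Measure X)

/-- A deterministic streaming algorithm with `b` bits of memory: its state is a string of `b`
bits, which is updated from each sample, and its output depends only on the final state. The
update rule is not given the number of the step: a clock has to be kept in memory. -/
structure StreamingAlgorithm (X : Type u) [MeasurableSpace X] (F : Type v) (b : ℕ) where
  init : Fin b → Bool
  update : (Fin b → Bool) → X → (Fin b → Bool)
  measurable_update : ∀ s, Measurable (update s)
  out : (Fin b → Bool) → F

/-- The solution output after the samples `x 0, …, x (n - 1)`, read in this order. -/
def StreamingAlgorithm.run {X : Type u} [MeasurableSpace X] {F : Type v} {b : ℕ}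
    (S : StreamingAlgorithm X F b) {n : ℕ} (x : Fin n → X) : F :=
  S.out (Fin.foldl n (fun s i => S.update s (x i)) S.init)

/-- `S` solves `Z` with probability at least `p` from `n` samples: for every input distribution
`D` of the class, the output on `n` i.i.d. samples from `D` is valid with probability `≥ p`. -/
def StreamingAlgorithm.SolvesWithProb {X : Type u} [MeasurableSpace X] {F : Type v} {b : ℕ}
    (S : StreamingAlgorithm X F b) (Z : SearchProblem X F) (n : ℕ) (p : ℝ) : Prop :=
  ∀ D : Z.dists,
    p ≤ (Measure.pi fun _ : Fin n => ((D : ProbabilityMeasure X) : Measure X)).real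
      {x | S.run x ∈ Z.valid D}

/-! ### The variational bound on KL divergence as a potential function. -/

section DonskerVaradhan

variable {X : Type u} [MeasurableSpace X]

/-! Let `P` be a distribution with `KL(D ‖ P) ≤ K` for every `D` in the class. The simulation keeps
a tilt `P.tilted W`, where `W` is `τ / 6` times an integer combination of the queries asked so far,
and answers each query by its mean under the tilt. The samples serve only to choose the next
integer: given an estimate of the query's mean within `τ / 3`, some multiple `z` of the query, added
to `W`, brings the tilted mean within `2τ / 3` of the estimate. The answer is then legal
(`exists_int_tilted_mean_close`).

The potential is `D[W] - log P[exp W]`. It starts at `0`, grows by at least `τ² / 36 * |z|` at each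
query, and never exceeds `KL(D ‖ P)`. Hence the integers have total size at most `T ≈ 36K / τ²`.
They determine the tilts, therefore the answers and the whole transcript (`replay`), so the integer
vector is all that has to be remembered. There are at most `(2q + 1) ^ T` such vectors, which gives
the `R / τ² * log q` bits. The step counter, the sample counter and the running sum of quantized
values account for the other bits.

Each query uses a fresh block of about `log (q / δ) / τ²` samples, by Hoeffding's inequality and a
union bound. The stated bounds carry a factor `R / τ²`; this is harmless because for `R < τ² / 4`
Pinsker's inequality makes the means under a suitable centre legal for all `D` at once, and one
constant output is valid. -/

/-- A bounded measurable real function. -/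
def BddMeasurable (W : X → ℝ) : Prop :=
  Measurable W ∧ ∃ B, ∀ x, |W x| ≤ B

lemma BddMeasurable.zero : BddMeasurable (fun _ : X => (0 : ℝ)) :=
  ⟨measurable_const, 0, by simp⟩

lemma StatQuery.bddMeasurable (φ : StatQuery X) : BddMeasurable φ.toFun :=
  ⟨φ.measurable_toFun, 1, fun x => abs_le.2 (φ.mem_Icc x)⟩

lemma BddMeasurable.add_const_mul {W V : X → ℝ} (hW : BddMeasurable W) (hV : BddMeasurable V)
    (t : ℝ) : BddMeasurable (fun x => W x + t * V x) := by
  obtain ⟨hWm, B, hB⟩ := hW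
  obtain ⟨hVm, B', hB'⟩ := hV
  refine ⟨hWm.add (hVm.const_mul t), B + |t| * B', fun x => (abs_add_le _ _).trans ?_⟩
  rw [abs_mul]
  exact add_le_add (hB x) (mul_le_mul_of_nonneg_left (hB' x) (abs_nonneg t))

lemma BddMeasurable.integrable {W : X → ℝ} (hW : BddMeasurable W) (P : Measure X)
    [IsFiniteMeasure P] : Integrable W P := by
  obtain ⟨hWm, B, hB⟩ := hW
  exact Integrable.of_bound hWm.aestronglyMeasurable B (Filter.Eventually.of_forall hB)

lemma BddMeasurable.exp {W : X → ℝ} (hW : BddMeasurable W) :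
    BddMeasurable (fun x => Real.exp (W x)) := by
  obtain ⟨hWm, B, hB⟩ := hW
  refine ⟨hWm.exp, Real.exp B, fun x => ?_⟩
  rw [abs_of_pos (Real.exp_pos _)]
  exact Real.exp_le_exp.2 ((le_abs_self _).trans (hB x))

/-- The functional of the Donsker–Varadhan variational formula. -/
noncomputable def donskerVaradhan (D P : Measure X) (W : X → ℝ) : ℝ :=
  ∫ x, W x ∂D - Real.log (∫ x, Real.exp (W x) ∂P)

lemma donskerVaradhan_zero (D P : Measure X) [IsProbabilityMeasure P] :
    donskerVaradhan D P (fun _ => 0) = 0 := by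
  simp [donskerVaradhan]

/-- The gap between the two sides is the integral under `D` of the log-likelihood ratio of `D` to
`P.tilted W`, that is `KL(D ‖ P.tilted W) ≥ 0`. -/
lemma donskerVaradhan_le_klDiv (D P : Measure X) [IsProbabilityMeasure D] [IsProbabilityMeasure P]
    (hkl : InformationTheory.klDiv D P ≠ ⊤) {W : X → ℝ} (hW : BddMeasurable W) :
    donskerVaradhan D P W ≤ (InformationTheory.klDiv D P).toReal := by
  obtain ⟨hac, hint⟩ := InformationTheory.klDiv_ne_top_iff.1 hkl
  have hexp := hW.exp.integrable P
  have : IsProbabilityMeasure (P.tilted W) := isProbabilityMeasure_tilted hexp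
  have h1 := integral_llr_tilted_right hac (hW.integrable D) hexp hint
  have hint' := integrable_llr_tilted_right hac (hW.integrable D) hint hexp
  have h2 := InformationTheory.integral_llr_add_sub_measure_univ_nonneg
    (hac.trans (absolutelyContinuous_tilted hexp)) hint'
  rw [InformationTheory.toReal_klDiv_of_measure_eq hac (by simp)]
  simp only [probReal_univ, add_sub_cancel_right] at h2
  unfold donskerVaradhan
  linarith

/-- Adding a small multiple `t` of a query to the exponent increases the Donsker–Varadhan
functional by `t` times the error of the tilted measure on the query, up to `t ^ 2`. -/
lemma donskerVaradhan_add_mul_ge (D P : Measure X) [IsProbabilityMeasure D]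
    [IsProbabilityMeasure P] {W : X → ℝ} (hW : BddMeasurable W) (φ : StatQuery X) {t : ℝ}
    (ht : |t| ≤ 1) :
    donskerVaradhan D P W
        + t * (∫ x, φ.toFun x ∂D - ∫ x, φ.toFun x ∂(P.tilted W)) - t ^ 2
      ≤ donskerVaradhan D P (fun x => W x + t * φ.toFun x) := by
  have hexp := hW.exp.integrable P
  have hprob : IsProbabilityMeasure (P.tilted W) := isProbabilityMeasure_tilted hexp
  have hφ := φ.bddMeasurable
  have hWφ := hW.add_const_mul hφ t
  have htφ : BddMeasurable (fun x => t * φ.toFun x) := by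
    simpa using BddMeasurable.zero.add_const_mul hφ t
  have hpos : 0 < ∫ x, Real.exp (W x) ∂P := integral_exp_pos hexp
  have hpos' : 0 < ∫ x, Real.exp (W x + t * φ.toFun x) ∂P :=
    integral_exp_pos (hWφ.exp.integrable P)
  -- The change of the log-partition function is the cumulant generating function of `φ` under the
  -- current tilt; it is bounded through `exp u ≤ 1 + u + u²` for `|u| ≤ 1`.
  have hratio : ∫ x, Real.exp (t * φ.toFun x) ∂(P.tilted W)
      = (∫ x, Real.exp (W x + t * φ.toFun x) ∂P) / ∫ x, Real.exp (W x) ∂P :=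
    integral_exp_tilted W (fun x => t * φ.toFun x)
  have hle : ∫ x, Real.exp (t * φ.toFun x) ∂(P.tilted W)
      ≤ 1 + t * ∫ x, φ.toFun x ∂(P.tilted W) + t ^ 2 := by
    have : ∫ x, (1 + t * φ.toFun x + t ^ 2) ∂(P.tilted W)
        = 1 + t * ∫ x, φ.toFun x ∂(P.tilted W) + t ^ 2 := by
      have hi : Integrable (fun x => 1 + t * φ.toFun x) (P.tilted W) :=
        (integrable_const _).add (htφ.integrable _)
      rw [integral_add hi (integrable_const _),
        integral_add (integrable_const _) (htφ.integrable _), integral_const_mul]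
      simp
    rw [← this]
    refine integral_mono (htφ.exp.integrable _)
      (((integrable_const _).add (htφ.integrable _)).add (integrable_const _)) fun x => ?_
    have hφx : |φ.toFun x| ≤ 1 := abs_le.2 (φ.mem_Icc x)
    have h1 : |t * φ.toFun x| ≤ 1 := by
      rw [abs_mul]; exact mul_le_one₀ ht (abs_nonneg _) hφx
    have h2 := (abs_le.1 (Real.abs_exp_sub_one_sub_id_le h1)).2
    have h3 : (t * φ.toFun x) ^ 2 ≤ t ^ 2 := by
      rw [mul_pow]
      exact mul_le_of_le_one_right (sq_nonneg t) ((sq_le_one_iff_abs_le_one _).2 hφx)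
    simp only
    linarith
  have hlog : Real.log (∫ x, Real.exp (W x + t * φ.toFun x) ∂P)
      - Real.log (∫ x, Real.exp (W x) ∂P) ≤ t * ∫ x, φ.toFun x ∂(P.tilted W) + t ^ 2 := by
    rw [← Real.log_div hpos'.ne' hpos.ne', ← hratio]
    have := Real.log_le_sub_one_of_pos (x := ∫ x, Real.exp (t * φ.toFun x) ∂(P.tilted W))
      (by rw [hratio]; positivity)
    linarith
  have hD : ∫ x, (W x + t * φ.toFun x) ∂D = ∫ x, W x ∂D + t * ∫ x, φ.toFun x ∂D := by
    rw [integral_add (hW.integrable D) (htφ.integrable D), integral_const_mul]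
  unfold donskerVaradhan
  rw [hD]
  linarith

/-- A form of Pinsker's inequality: a small divergence makes the mean of a query almost equal. -/
lemma abs_mean_sub_le_of_klDiv_le (D P : Measure X) [IsProbabilityMeasure D]
    [IsProbabilityMeasure P] (φ : StatQuery X) {τ : ℝ} (h0 : 0 < τ) (h1 : τ ≤ 1)
    (hkl : InformationTheory.klDiv D P ≤ ENNReal.ofReal (τ ^ 2 / 4)) :
    |∫ x, φ.toFun x ∂P - ∫ x, φ.toFun x ∂D| ≤ τ := by
  have hne : InformationTheory.klDiv D P ≠ ⊤ := ne_top_of_le_ne_top ENNReal.ofReal_ne_top hkl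
  have hle : (InformationTheory.klDiv D P).toReal ≤ τ ^ 2 / 4 :=
    ENNReal.toReal_le_of_le_ofReal (by positivity) hkl
  have key : ∀ t : ℝ, |t| ≤ 1 →
      t * (∫ x, φ.toFun x ∂D - ∫ x, φ.toFun x ∂P) - t ^ 2 ≤ τ ^ 2 / 4 := by
    intro t ht
    have h2 := donskerVaradhan_add_mul_ge D P BddMeasurable.zero φ ht
    have h3 := donskerVaradhan_le_klDiv D P hne
      (BddMeasurable.zero.add_const_mul φ.bddMeasurable t)
    rw [donskerVaradhan_zero] at h2
    have h4 : P.tilted (fun _ => (0 : ℝ)) = P := by simp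
    rw [h4] at h2
    linarith
  -- The choice `t = ± τ / 2` balances `t²` against `τ² / 4`.
  have hp := key (τ / 2) (by rw [abs_of_pos] <;> linarith)
  have hm := key (-(τ / 2)) (by rw [abs_neg, abs_of_pos] <;> linarith)
  rw [abs_le]
  constructor <;> nlinarith

/-- Some integer multiple of a query can be added to the exponent so that the tilted mean of the
query gets close to `p`, and the Donsker–Varadhan functional increases for every distribution whose
mean is really close to `p`. -/
lemma exists_int_tilted_mean_close (P : Measure X) [IsProbabilityMeasure P] {W : X → ℝ}
    (hW : BddMeasurable W) (φ : StatQuery X) {τ : ℝ} (h0 : 0 < τ) (h1 : τ ≤ 1) (p : ℝ)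
    (hex : ∃ D : ProbabilityMeasure X, InformationTheory.klDiv (D : Measure X) P ≠ ⊤ ∧
      |p - φ.mean D| ≤ τ / 3) :
    ∃ z : ℤ, |∫ x, φ.toFun x ∂(P.tilted fun x => W x + τ / 6 * z * φ.toFun x) - p| ≤ 2 * τ / 3 ∧
      ∀ D : ProbabilityMeasure X, |p - φ.mean D| ≤ τ / 3 →
        donskerVaradhan D P W + τ ^ 2 / 36 * |(z : ℝ)|
          ≤ donskerVaradhan D P (fun x => W x + τ / 6 * z * φ.toFun x) := by
  by_contra! hno
  -- If no `z` works, a walk by unit steps towards `p` never stops: after `n` steps the gain is at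
  -- least `n` units although `|z| ≤ n`. This eventually exceeds the finite divergence of the
  -- distribution in `hex`.
  have hall : ∀ n : ℕ, ∃ z : ℤ, |(z : ℝ)| ≤ n ∧
      ∀ D : ProbabilityMeasure X, |p - φ.mean D| ≤ τ / 3 →
        donskerVaradhan D P W + τ ^ 2 / 36 * n
          ≤ donskerVaradhan D P (fun x => W x + τ / 6 * z * φ.toFun x) := by
    intro n
    induction n with
    | zero => exact ⟨0, by simp⟩
    | succ n ih =>
      obtain ⟨z, hzn, hz⟩ := ih
      have hfar : 2 * τ / 3
          < |∫ x, φ.toFun x ∂(P.tilted fun x => W x + τ / 6 * z * φ.toFun x) - p| := by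
        by_contra! hclose
        obtain ⟨D, hD, hlt⟩ := hno z hclose
        have := hz D hD
        have : τ ^ 2 / 36 * |(z : ℝ)| ≤ τ ^ 2 / 36 * n := by gcongr
        linarith
      have hstep : ∀ s : ℤ, |(s : ℝ)| = 1 →
          2 * τ / 3 < s * (p - ∫ x, φ.toFun x ∂(P.tilted fun x => W x + τ / 6 * z * φ.toFun x)) →
          ∃ z : ℤ, |(z : ℝ)| ≤ (n + 1 : ℕ) ∧
            ∀ D : ProbabilityMeasure X, |p - φ.mean D| ≤ τ / 3 →
              donskerVaradhan D P W + τ ^ 2 / 36 * (n + 1 : ℕ)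
                ≤ donskerVaradhan D P (fun x => W x + τ / 6 * z * φ.toFun x) := by
        intro s hs hlt
        refine ⟨z + s, ?_, fun D hD => ?_⟩
        · push_cast
          exact (abs_add_le _ _).trans (by rw [hs]; linarith)
        · have h2 := donskerVaradhan_add_mul_ge D P
            (hW.add_const_mul φ.bddMeasurable (τ / 6 * z)) φ (t := τ / 6 * s)
            (by rw [abs_mul, hs, abs_of_pos] <;> linarith)
          have h3 := hz D hD
          have h4 : (fun x => W x + τ / 6 * (z + s : ℤ) * φ.toFun x)
              = fun x => W x + τ / 6 * z * φ.toFun x + τ / 6 * s * φ.toFun x := by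
            funext x; push_cast; ring
          rw [h4]
          have h5 : (s : ℝ) * (p - φ.mean D) ≤ τ / 3 := by
            refine (le_abs_self _).trans ?_
            rw [abs_mul, hs, one_mul]; exact hD
          have h6 : (s : ℝ) ^ 2 = 1 := by rw [← sq_abs, hs, one_pow]
          unfold StatQuery.mean at h5
          -- The tilted mean is `2τ / 3` away from `p`, and `p` is within `τ / 3` of the true mean.
          -- A step of size `τ / 6` thus gains `τ / 6 * (τ / 3) - (τ / 6)² = τ² / 36`.
          have h7 : τ / 3 ≤ s * (∫ x, φ.toFun x ∂(D : Measure X)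
              - ∫ x, φ.toFun x ∂(P.tilted fun x => W x + τ / 6 * z * φ.toFun x)) := by
            linarith
          have h8 : τ / 6 * (τ / 3) ≤ τ / 6 * (s * (∫ x, φ.toFun x ∂(D : Measure X)
              - ∫ x, φ.toFun x ∂(P.tilted fun x => W x + τ / 6 * z * φ.toFun x))) :=
            mul_le_mul_of_nonneg_left h7 (by positivity)
          have h9 : (τ / 6 * (s : ℝ)) ^ 2 = τ ^ 2 / 36 := by rw [mul_pow, h6]; ring
          rw [h9] at h2
          push_cast
          linarith
      rcases lt_abs.1 hfar with h | h
      · exact hstep (-1) (by simp) (by push_cast; linarith)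
      · exact hstep 1 (by simp) (by push_cast; linarith)
  obtain ⟨D, hkl, hD⟩ := hex
  obtain ⟨n, hn⟩ := exists_nat_gt
    (((InformationTheory.klDiv (D : Measure X) P).toReal - donskerVaradhan D P W) / (τ ^ 2 / 36))
  rw [div_lt_iff₀ (by positivity)] at hn
  obtain ⟨z, -, hz⟩ := hall n
  have h2 := hz D hD
  have h3 := donskerVaradhan_le_klDiv D P hkl
    (hW.add_const_mul φ.bddMeasurable (τ / 6 * z))
  linarith

end DonskerVaradhan

/-! ### Finiteness of the KL-radius and near-optimal centres. -/

section KLRadius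

variable {X : Type u} [MeasurableSpace X]

/-- The density is almost everywhere in `[0, N]`, where `x log x` is bounded. -/
lemma klDiv_ne_top_of_le_smul (D P : Measure X) [IsProbabilityMeasure D] [IsProbabilityMeasure P]
    (N : NNReal) (h : D ≤ N • P) : InformationTheory.klDiv D P ≠ ⊤ := by
  have hac : D ≪ P := (Measure.absolutelyContinuous_of_le h).trans
    Measure.smul_absolutelyContinuous
  have hr : D.rnDeriv P ≤ᵐ[P] fun _ => (N : ENNReal) := by
    refine ae_le_of_forall_setLIntegral_le_of_sigmaFinite (Measure.measurable_rnDeriv _ _) ?_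
    intro s hs _
    rw [Measure.setLIntegral_rnDeriv hac, setLIntegral_const]
    exact h s
  refine InformationTheory.klDiv_ne_top hac ?_
  rw [← integrable_rnDeriv_mul_log_iff hac]
  obtain ⟨B, hB⟩ := (isCompact_Icc (a := (0 : ℝ)) (b := N)).exists_bound_of_continuousOn
    Real.continuous_mul_log.continuousOn
  refine Integrable.of_bound ?_ B ?_
  · exact (Real.continuous_mul_log.measurable.comp
      (Measure.measurable_rnDeriv D P).ennreal_toReal).aestronglyMeasurable
  · filter_upwards [hr] with x hx
    exact hB _ ⟨ENNReal.toReal_nonneg, ENNReal.toReal_le_coe_of_le_coe hx⟩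

/-- The uniform mixture `P` of the class satisfies `D ≤ |𝒟| • P` for each member. Finiteness matters
because `toReal` would send an infinite radius to `0`. -/
lemma klRadius_ne_top {𝒟 : Set (ProbabilityMeasure X)} (hfin : 𝒟.Finite) (hne : 𝒟.Nonempty) :
    klRadius 𝒟 ≠ ⊤ := by
  classical
  set s := hfin.toFinset with hs
  have hcard : s.card ≠ 0 := by
    rw [Finset.card_ne_zero]; simpa [hs] using hne
  let P : Measure X := ((s.card : NNReal)⁻¹) • ∑ D ∈ s, (D : Measure X)
  have hP : IsProbabilityMeasure P := by
    constructor
    simp only [P, Measure.smul_apply, Measure.finsetSum_apply, measure_univ, Finset.sum_const]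
    rw [nsmul_eq_mul, mul_one, ENNReal.smul_def, smul_eq_mul, ENNReal.coe_inv (by simpa using hcard)]
    simpa using ENNReal.inv_mul_cancel (a := (s.card : ENNReal)) (by simpa using hcard) (by simp)
  have hkl : ∀ D ∈ 𝒟, InformationTheory.klDiv (D : Measure X) P ≠ ⊤ := by
    intro D hD
    refine klDiv_ne_top_of_le_smul _ _ (s.card : NNReal) ?_
    simp only [P]
    rw [smul_smul, mul_inv_cancel₀ (by simpa using hcard), one_smul]
    exact Finset.single_le_sum (f := fun D : ProbabilityMeasure X => (D : Measure X))
      (fun _ _ => Measure.zero_le _) (by simpa [hs] using hD)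
  refine ne_top_of_le_ne_top ?_ (iInf_le _ (⟨P, hP⟩ : ProbabilityMeasure X))
  have : (⨆ D ∈ 𝒟, InformationTheory.klDiv (D : Measure X) P)
      ≤ ∑ D ∈ s, InformationTheory.klDiv (D : Measure X) P :=
    iSup₂_le fun D hD => Finset.single_le_sum
      (f := fun D : ProbabilityMeasure X => InformationTheory.klDiv (D : Measure X) P)
      (fun _ _ => zero_le) (by simpa [hs] using hD)
  refine ne_top_of_le_ne_top ?_ this
  rw [ENNReal.sum_ne_top]
  intro D hD
  exact hkl D (by simpa [hs] using hD)

/-- Every bound above the KL-radius is attained by some centre. -/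
lemma exists_klDiv_lt_of_klRadius_lt {𝒟 : Set (ProbabilityMeasure X)} {c : ENNReal}
    (h : klRadius 𝒟 < c) :
    ∃ P : ProbabilityMeasure X, ∀ D ∈ 𝒟,
      InformationTheory.klDiv (D : Measure X) (P : Measure X) < c := by
  obtain ⟨P, hP⟩ := iInf_lt_iff.1 h
  exact ⟨P, fun D hD => (le_iSup₂ (f := fun (D : ProbabilityMeasure X) (_ : D ∈ 𝒟) =>
    InformationTheory.klDiv (D : Measure X) (P : Measure X)) D hD).trans_lt hP⟩

end KLRadius

/-! ### Hitting probabilities of a state machine driven by i.i.d. samples. -/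

section FoldProbability

variable {X : Type u} [MeasurableSpace X] {S : Type*}

lemma measurable_foldl [MeasurableSpace S] [Countable S] [MeasurableSingletonClass S]
    {upd : S → X → S} (hupd : ∀ s, Measurable (upd s)) (n : ℕ) (s : S) :
    Measurable fun x : Fin n → X => Fin.foldl n (fun s i => upd s (x i)) s := by
  induction n with
  | zero => simp
  | succ n ih =>
    simp only [Fin.foldl_succ_last]
    have h1 : Measurable (fun p : S × X => upd p.1 p.2) :=
      measurable_from_prod_countable_right hupd
    have h2 : Measurable fun x : Fin (n + 1) → X =>
        Fin.foldl n (fun s i => upd s (x i.castSucc)) s :=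
      ih.comp (measurable_pi_lambda _ fun i => measurable_pi_apply _)
    exact h1.comp (h2.prodMk (measurable_pi_apply _))

/-- The probability that `n` i.i.d. samples from `D` lead from the state `s` into `E`. -/
noncomputable def foldProb (D : Measure X) (upd : S → X → S) (n : ℕ) (s : S) (E : Set S) :
    ENNReal :=
  (Measure.pi fun _ : Fin n => D) {x | Fin.foldl n (fun s i => upd s (x i)) s ∈ E}

variable (D : Measure X) [IsProbabilityMeasure D] {upd : S → X → S}

lemma foldProb_zero (s : S) (E : Set S) [Decidable (s ∈ E)] :
    foldProb D upd 0 s E = if s ∈ E then 1 else 0 := by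
  by_cases h : s ∈ E <;> simp [foldProb, h]

variable [MeasurableSpace S] [Countable S] [MeasurableSingletonClass S]

/-- Fubini, with the first sample split off: the Markov property of the state. -/
lemma foldProb_succ (hupd : ∀ s, Measurable (upd s)) (n : ℕ) (s : S) (E : Set S) :
    foldProb D upd (n + 1) s E = ∫⁻ x, foldProb D upd n (upd s x) E ∂D := by
  have hmeas : MeasurableSet
      {p : X × (Fin n → X) | Fin.foldl n (fun s i => upd s (p.2 i)) (upd s p.1) ∈ E} := by
    have h1 : Measurable (fun p : S × (Fin n → X) =>
        Fin.foldl n (fun s i => upd s (p.2 i)) p.1) :=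
      measurable_from_prod_countable_right fun s => measurable_foldl hupd n s
    exact (h1.comp (((hupd s).comp measurable_fst).prodMk measurable_snd))
      (Set.to_countable E).measurableSet
  have h := (measurePreserving_piFinSuccAbove (fun _ : Fin (n + 1) => D) 0).measure_preimage
    hmeas.nullMeasurableSet
  rw [Measure.prod_apply hmeas] at h
  unfold foldProb
  simp only [Fin.foldl_succ]
  exact h

/-- If `n` samples lead from every state of `G` into `E` with probability at most `b`, the
probability to be in `E` after `m + n` samples exceeds that of leaving `G` after `m` samples by at
most `b`. -/
lemma foldProb_add_le (hupd : ∀ s, Measurable (upd s)) {n : ℕ} {E G : Set S} {b : ENNReal}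
    (hG : ∀ s ∈ G, foldProb D upd n s E ≤ b) (m : ℕ) (s : S) :
    foldProb D upd (m + n) s E ≤ foldProb D upd m s Gᶜ + b := by
  classical
  induction m generalizing s with
  | zero =>
    rw [foldProb_zero, zero_add]
    by_cases hs : s ∈ G
    · exact (hG s hs).trans le_add_self
    · rw [if_pos (by exact hs)]
      exact prob_le_one.trans le_self_add
  | succ m ih =>
    rw [Nat.add_right_comm, foldProb_succ D hupd, foldProb_succ D hupd]
    calc ∫⁻ x, foldProb D upd (m + n) (upd s x) E ∂D
        ≤ ∫⁻ x, (foldProb D upd m (upd s x) Gᶜ + b) ∂D := lintegral_mono fun x => ih _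
      _ = _ := by
        rw [lintegral_add_right _ measurable_const]; simp

/-- A union bound over the blocks. The query of a block depends on earlier samples, so the bound `b`
is required from every good starting state. -/
lemma foldProb_blocks_le (hupd : ∀ s, Measurable (upd s)) {m : ℕ} {b : ENNReal} {q : ℕ}
    (G : ℕ → Set S) (hG : ∀ i < q, ∀ s ∈ G i, foldProb D upd m s (G (i + 1))ᶜ ≤ b) {s : S}
    (hs : s ∈ G 0) : foldProb D upd (q * m) s (G q)ᶜ ≤ q * b := by
  classical
  have key : ∀ r i, i + r = q → ∀ s ∈ G i, foldProb D upd (r * m) s (G q)ᶜ ≤ r * b := by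
    intro r
    induction r with
    | zero =>
      rintro i rfl s hs
      rw [Nat.zero_mul, foldProb_zero]
      rw [if_neg (fun h => h (by simpa using hs))]
      exact zero_le
    | succ r ih =>
      intro i hi s hs
      rw [Nat.succ_mul, Nat.add_comm]
      refine (foldProb_add_le D hupd (ih (i + 1) (by omega)) m s).trans ?_
      push_cast
      rw [add_mul, one_mul, add_comm]
      gcongr
      exact hG i (by omega) s hs
  exact key q 0 (by omega) s hs

end FoldProbability

/-! ### Estimating the mean of a query from quantized values. -/

section Hoeffding

variable {X : Type u} [MeasurableSpace X]

/-- The value of a query, shifted to `[0, 2]` and rounded down to a multiple of `1 / k`. -/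
noncomputable def StatQuery.quantized (φ : StatQuery X) (k : ℕ) (x : X) : ℕ :=
  ⌊(φ.toFun x + 1) * k⌋₊

lemma StatQuery.measurable_quantized (φ : StatQuery X) (k : ℕ) : Measurable (φ.quantized k) :=
  Nat.measurable_floor.comp ((φ.measurable_toFun.add_const 1).mul_const _)

lemma StatQuery.quantized_le (φ : StatQuery X) (k : ℕ) (x : X) : φ.quantized k x ≤ 2 * k := by
  refine Nat.floor_le_of_le ?_
  push_cast
  have := (φ.mem_Icc x).2
  gcongr
  linarith

lemma StatQuery.abs_quantized_div_sub_le (φ : StatQuery X) {k : ℕ} (hk : 0 < k) (x : X) :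
    |(φ.quantized k x : ℝ) / k - 1 - φ.toFun x| ≤ 1 / k := by
  have hk' : (0 : ℝ) < k := by exact_mod_cast hk
  have h0 : 0 ≤ (φ.toFun x + 1) * k := mul_nonneg (by linarith [(φ.mem_Icc x).1]) hk'.le
  have h1 := Nat.floor_le h0
  have h2 := Nat.lt_floor_add_one ((φ.toFun x + 1) * k)
  have h3 : (φ.quantized k x : ℝ) / k - 1 - φ.toFun x
      = ((φ.quantized k x : ℝ) - (φ.toFun x + 1) * k) / k := by field_simp; ring
  rw [h3, abs_div, abs_of_pos hk']
  gcongr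
  rw [abs_le]
  unfold StatQuery.quantized
  constructor <;> linarith

/-- The estimate of the mean of a query computed from a sum of quantized values. -/
noncomputable def estimate (k m s : ℕ) : ℝ := s / (k * m) - 1

/-- Hoeffding's inequality for the mean of a bounded function on i.i.d. samples. -/
lemma measureReal_pi_abs_sum_sub_ge_le (D : Measure X) [IsProbabilityMeasure D] {ψ : X → ℝ}
    (hψ : Measurable ψ) (hψ' : ∀ x, ψ x ∈ Set.Icc (0 : ℝ) 2) (m : ℕ) {ε : ℝ} (hε : 0 ≤ ε) :
    (Measure.pi fun _ : Fin m => D).real {x | ε ≤ |∑ i, (ψ (x i) - ∫ y, ψ y ∂D)|}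
      ≤ 2 * Real.exp (-ε ^ 2 / (2 * m)) := by
  set c : ℝ := ∫ y, ψ y ∂D with hc
  have hsub : ∀ s : ℝ, s = 1 ∨ s = -1 →
      (Measure.pi fun _ : Fin m => D).real {x | ε ≤ ∑ i, s * (ψ (x i) - c)}
        ≤ Real.exp (-ε ^ 2 / (2 * m)) := by
    intro s hs
    have hbase : ProbabilityTheory.HasSubgaussianMGF (fun y => s * (ψ y - c)) 1 D := by
      have h := ProbabilityTheory.hasSubgaussianMGF_of_mem_Icc (μ := D) hψ.aemeasurable
        (Filter.Eventually.of_forall hψ')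
      have h1 : ((‖(2 : ℝ) - 0‖₊ / 2) ^ 2 : NNReal) = 1 := by
        ext; simp
      rw [h1, ← hc] at h
      rcases hs with rfl | rfl
      · simpa using h
      · have h2 := h.neg
        refine h2.congr (Filter.Eventually.of_forall fun x => ?_)
        simp
    have hind : ProbabilityTheory.iIndepFun
        (fun (i : Fin m) (x : Fin m → X) => s * (ψ (x i) - c)) (Measure.pi fun _ : Fin m => D) :=
      ProbabilityTheory.iIndepFun_pi (X := fun _ y => s * (ψ y - c)) fun i =>
        ((hψ.sub_const c).const_mul s).aemeasurable
    have := ProbabilityTheory.HasSubgaussianMGF.measure_sum_ge_le_of_iIndepFun hind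
      (c := fun _ => 1) (s := Finset.univ) (fun i _ => by
        refine ProbabilityTheory.HasSubgaussianMGF.of_map (Y := fun x : Fin m → X => x i)
          (X := fun y => s * (ψ y - c)) (measurable_pi_apply i).aemeasurable ?_
        rw [(measurePreserving_eval (fun _ : Fin m => D) i).map_eq]
        exact hbase) hε
    simpa using this
  have hcover : {x : Fin m → X | ε ≤ |∑ i, (ψ (x i) - c)|}
      ⊆ {x | ε ≤ ∑ i, 1 * (ψ (x i) - c)} ∪ {x | ε ≤ ∑ i, -1 * (ψ (x i) - c)} := by
    intro x hx
    rcases le_abs.1 (Set.mem_ofPred.1 hx) with h | h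
    · left; simpa using h
    · right
      simpa only [Set.mem_ofPred_eq, neg_one_mul, Finset.sum_neg_distrib] using h
  refine (measureReal_mono hcover).trans ((measureReal_union_le _ _).trans ?_)
  have h1 := hsub 1 (Or.inl rfl)
  have h2 := hsub (-1) (Or.inr rfl)
  linarith

/-- Rounding costs at most `1 / k ≤ τ / 6`, which leaves `τ / 6` of the tolerance for the sampling
error. -/
lemma measure_pi_estimate_far_le (D : ProbabilityMeasure X) (φ : StatQuery X) {τ : ℝ} {k m : ℕ}
    (hτ : 0 < τ) (hk : 6 / τ ≤ k) (hm : 0 < m) :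
    (Measure.pi fun _ : Fin m => (D : Measure X))
        {x | τ / 3 < |estimate k m (∑ i, φ.quantized k (x i)) - φ.mean D|}
      ≤ ENNReal.ofReal (2 * Real.exp (-(m * τ ^ 2 / 72))) := by
  have hk' : (0 : ℝ) < k := lt_of_lt_of_le (by positivity) hk
  have hk0 : 0 < k := by exact_mod_cast hk'
  have hm' : (0 : ℝ) < m := by exact_mod_cast hm
  set ψ : X → ℝ := fun x => (φ.quantized k x : ℝ) / k with hψdef
  have hψ : Measurable ψ :=
    (measurable_from_nat (f := fun n : ℕ => (n : ℝ))).comp (φ.measurable_quantized k) |>.div_const _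
  have hψ' : ∀ x, ψ x ∈ Set.Icc (0 : ℝ) 2 := by
    intro x
    refine ⟨by positivity, ?_⟩
    rw [hψdef]
    simp only
    rw [div_le_iff₀ hk']
    exact_mod_cast φ.quantized_le k x
  have h1k : (1 : ℝ) / k ≤ τ / 6 := by
    rw [div_le_iff₀ hτ] at hk
    rw [div_le_iff₀ hk']
    linarith
  have hψint : Integrable ψ (D : Measure X) :=
    Integrable.of_mem_Icc 0 2 hψ.aemeasurable (Filter.Eventually.of_forall hψ')
  have hmean : |∫ y, ψ y ∂(D : Measure X) - 1 - φ.mean D| ≤ τ / 6 := by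
    have : ∫ y, ψ y ∂(D : Measure X) - 1 - φ.mean D
        = ∫ y, (ψ y - 1 - φ.toFun y) ∂(D : Measure X) := by
      have hi : Integrable (fun y => ψ y - 1) (D : Measure X) :=
        hψint.sub (integrable_const _)
      rw [integral_sub hi (φ.bddMeasurable.integrable _),
        integral_sub hψint (integrable_const _)]
      simp [StatQuery.mean]
    rw [this, ← Real.norm_eq_abs]
    refine (norm_integral_le_of_norm_le_const (C := τ / 6)
      (Filter.Eventually.of_forall fun y => ?_)).trans (by simp)
    exact (φ.abs_quantized_div_sub_le hk0 y).trans h1k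
  have hsubset : {x : Fin m → X |
      τ / 3 < |estimate k m (∑ i, φ.quantized k (x i)) - φ.mean D|}
      ⊆ {x | m * τ / 6 ≤ |∑ i, (ψ (x i) - ∫ y, ψ y ∂(D : Measure X))|} := by
    intro x hx
    simp only [Set.mem_ofPred_eq] at hx ⊢
    have heq : ∑ i, (ψ (x i) - ∫ y, ψ y ∂(D : Measure X))
        = m * (estimate k m (∑ i, φ.quantized k (x i)) + 1 - ∫ y, ψ y ∂(D : Measure X)) := by
      rw [Finset.sum_sub_distrib]
      simp only [hψdef, estimate, Finset.sum_const, Finset.card_univ, Fintype.card_fin,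
        nsmul_eq_mul, ← Finset.sum_div]
      push_cast
      field_simp
      ring
    rw [heq, abs_mul, abs_of_pos hm', mul_div_assoc]
    refine mul_le_mul_of_nonneg_left ?_ hm'.le
    have h3 := abs_sub_abs_le_abs_sub
      (estimate k m (∑ i, φ.quantized k (x i)) - φ.mean D)
      (∫ y, ψ y ∂(D : Measure X) - 1 - φ.mean D)
    have h4 : estimate k m (∑ i, φ.quantized k (x i)) - φ.mean D
        - (∫ y, ψ y ∂(D : Measure X) - 1 - φ.mean D)
        = estimate k m (∑ i, φ.quantized k (x i)) + 1 - ∫ y, ψ y ∂(D : Measure X) := by ring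
    rw [h4] at h3
    linarith
  have hH := measureReal_pi_abs_sum_sub_ge_le (D : Measure X) hψ hψ' m
    (ε := m * τ / 6) (by positivity)
  have hexp : -(m * τ / 6) ^ 2 / (2 * m) = -(m * τ ^ 2 / 72) := by field_simp; ring
  rw [hexp] at hH
  refine (measure_mono hsubset).trans ?_
  rw [← ofReal_measureReal]
  exact ENNReal.ofReal_le_ofReal hH

end Hoeffding

/-! ### Reading the samples in blocks, one block per query. -/

section BlockStreaming

variable {X : Type u} {Cfg : Type*}

/-- One step of the algorithm that reads the samples in blocks of `m + 1`, adds up the values `g c`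
of the samples of a block, where `c` is the current configuration, and passes to the next
configuration at the end of the block. -/
def blockUpdate (m B : ℕ) (g : Cfg → X → ℕ) (next : Cfg → ℕ → Cfg) :
    Cfg × Fin (m + 1) × Fin (B + 1) → X → Cfg × Fin (m + 1) × Fin (B + 1) :=
  fun s x =>
    if h : (s.2.1 : ℕ) + 1 < m + 1 then
      (s.1, ⟨s.2.1 + 1, h⟩, ⟨min (s.2.2 + g s.1 x) B, by omega⟩)
    else (next s.1 (min (s.2.2 + g s.1 x) B), 0, 0)

variable {m B : ℕ} {g : Cfg → X → ℕ} {next : Cfg → ℕ → Cfg}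

lemma measurable_blockUpdate [MeasurableSpace X] [MeasurableSpace Cfg] (hg : ∀ c, Measurable (g c))
    (s : Cfg × Fin (m + 1) × Fin (B + 1)) : Measurable (blockUpdate m B g next s) := by
  have : blockUpdate m B g next s = (fun n : ℕ =>
      if h : (s.2.1 : ℕ) + 1 < m + 1 then
        (s.1, (⟨s.2.1 + 1, h⟩ : Fin (m + 1)), (⟨min (s.2.2 + n) B, by omega⟩ : Fin (B + 1)))
      else (next s.1 (min (s.2.2 + n) B), 0, 0)) ∘ g s.1 := rfl
  rw [this]
  exact measurable_from_nat.comp (hg s.1)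

lemma foldl_blockUpdate_of_le (c : Cfg) (x : ℕ → X) (n : ℕ) (hn : n < m + 1) :
    Fin.foldl n (fun s (i : Fin n) => blockUpdate m B g next s (x i)) (c, 0, 0)
      = (c, ⟨n, hn⟩, ⟨min (∑ i ∈ Finset.range n, g c (x i)) B, by omega⟩) := by
  induction n with
  | zero => simp
  | succ n ih =>
    rw [Fin.foldl_succ_last]
    simp only [Fin.val_castSucc, Fin.val_last]
    rw [ih (by omega)]
    simp only [blockUpdate, dif_pos hn, Prod.mk.injEq, Fin.mk.injEq, true_and,
      Finset.sum_range_succ]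
    omega

lemma foldl_blockUpdate (c : Cfg) (x : Fin (m + 1) → X) :
    Fin.foldl (m + 1) (fun s i => blockUpdate m B g next s (x i)) (c, 0, 0)
      = (next c (min (∑ i, g c (x i)) B), 0, 0) := by
  obtain ⟨y, hy⟩ : ∃ y : ℕ → X, ∀ i : Fin (m + 1), x i = y i :=
    ⟨fun n => x (Fin.ofNat (m + 1) n), fun i => by simp⟩
  simp only [hy]
  rw [Fin.foldl_succ_last]
  simp only [Fin.val_castSucc, Fin.val_last]
  rw [foldl_blockUpdate_of_le c y m (by omega), Fin.sum_univ_eq_sum_range (fun i => g c (y i)),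
    Finset.sum_range_succ]
  simp only [blockUpdate, lt_irrefl, dif_neg, not_false_eq_true, Prod.mk.injEq, and_true]
  congr 1
  omega

/-- If the configurations stay in `G i` as long as all estimates are accurate, then the block
algorithm is in `G q` after `q` blocks with large probability. -/
lemma foldProb_blockUpdate_le [MeasurableSpace X] [MeasurableSpace Cfg] [Countable Cfg] [MeasurableSingletonClass Cfg]
    (D : ProbabilityMeasure X) (qry : Cfg → StatQuery X) {τ : ℝ} {k : ℕ}
    (hτ : 0 < τ) (hk : 6 / τ ≤ k) {q : ℕ} (G : ℕ → Set Cfg)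
    (hG : ∀ i < q, ∀ c ∈ G i, ∀ s : ℕ, |estimate k (m + 1) s - (qry c).mean D| ≤ τ / 3 →
      next c s ∈ G (i + 1)) {c : Cfg} (hc : c ∈ G 0) :
    foldProb (D : Measure X)
        (blockUpdate m (2 * k * (m + 1)) (fun c => (qry c).quantized k) next) (q * (m + 1))
        (c, 0, 0) {s | s.1 ∉ G q}
      ≤ q * ENNReal.ofReal (2 * Real.exp (-((m + 1 : ℕ) * τ ^ 2 / 72))) := by
  have h := foldProb_blocks_le (D : Measure X) (q := q) (m := m + 1)
    (b := ENNReal.ofReal (2 * Real.exp (-((m + 1 : ℕ) * τ ^ 2 / 72))))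
    (measurable_blockUpdate (m := m) (B := 2 * k * (m + 1))
      (g := fun c => (qry c).quantized k) (next := next)
      (fun c => (qry c).measurable_quantized k))
    -- At a block boundary a good state must also have both counters reset.
    (fun i => {s | s.1 ∈ G i ∧ s.2 = (0, 0)}) ?_ (s := (c, 0, 0)) ⟨hc, rfl⟩
  · refine le_trans (measure_mono fun x hx => ?_) h
    exact fun h => hx h.1
  · rintro i hi ⟨c, j⟩ ⟨hc, rfl⟩
    refine le_trans (measure_mono fun x hx => ?_)
      (measure_pi_estimate_far_le D (qry c) hτ hk (Nat.succ_pos m))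
    simp only [Set.mem_ofPred_eq, Set.mem_compl_iff, foldl_blockUpdate, and_true] at hx ⊢
    by_contra! hle
    refine hx ?_
    -- The cap `2 * k * (m + 1)` is never active: each of the `m + 1` quantized values is at most `2
    -- * k`.
    rw [min_eq_left]
    · exact hG i hi c hc _ hle
    · refine (Finset.sum_le_card_nsmul _ _ _ fun i _ => (qry c).quantized_le k (x i)).trans ?_
      simp [mul_comm]

end BlockStreaming

/-! ### Encoding finite state spaces by bit strings. -/

section FiniteStates

variable {X : Type u} [MeasurableSpace X] {F : Type v} {S : Type*}

/-- A streaming algorithm with finitely many states can be run on strings of bits. -/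
lemma exists_streamingAlgorithm_run [MeasurableSpace S] [MeasurableSingletonClass S] [Finite S]
    {upd : S → X → S} (hupd : ∀ s, Measurable (upd s)) (s₀ : S) (out : S → F) {b : ℕ}
    (hb : Nat.card S ≤ 2 ^ b) :
    ∃ A : StreamingAlgorithm X F b, ∀ (n : ℕ) (x : Fin n → X),
      A.run x = out (Fin.foldl n (fun s i => upd s (x i)) s₀) := by
  have : Fintype S := Fintype.ofFinite S
  have : Nonempty S := ⟨s₀⟩
  obtain ⟨e⟩ : Nonempty (S ↪ (Fin b → Bool)) := by
    rw [Function.Embedding.nonempty_iff_card_le]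
    simpa using hb
  have hinv : ∀ s, Function.invFun e (e s) = s := Function.leftInverse_invFun e.injective
  refine ⟨⟨e s₀, fun s x => e (upd (Function.invFun e s) x), fun s =>
    (measurable_of_finite e).comp (hupd _), fun s => out (Function.invFun e s)⟩, fun n x => ?_⟩
  simp only [StreamingAlgorithm.run]
  have : Fin.foldl n (fun s i => e (upd (Function.invFun e s) (x i))) (e s₀)
      = e (Fin.foldl n (fun s i => upd s (x i)) s₀) := by
    induction n with
    | zero => simp
    | succ n ih => rw [Fin.foldl_succ_last, Fin.foldl_succ_last, ih (fun i => x i.castSucc), hinv]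
  rw [this, hinv]

end FiniteStates

/-! ### Counting integer vectors of small `ℓ₁`-norm. -/

section BoundedVectors

/-- The integer vectors of length `q` and `ℓ₁`-norm at most `T`. -/
def boundedVectors (q T : ℕ) : Set (ℕ → ℤ) :=
  {z | (∀ j, q ≤ j → z j = 0) ∧ ∑ j ∈ Finset.range q, (z j).natAbs ≤ T}

lemma zero_mem_boundedVectors (q T : ℕ) : (fun _ => 0) ∈ boundedVectors q T := by
  simp [boundedVectors]

/-- Moving one nonzero coordinate a unit towards zero lowers the norm by one. Undoing this is one of
`2q` signed unit moves, and `none` covers vectors already short enough. -/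
lemma boundedVectors_succ_subset (q T : ℕ) :
    boundedVectors q (T + 1) ⊆
      (fun p : (ℕ → ℤ) × Option (Fin q × Bool) => match p.2 with
        | none => p.1
        | some (i, s) => Function.update p.1 i (p.1 i + if s then 1 else -1)) ''
      (boundedVectors q T ×ˢ Set.univ) := by
  rintro z ⟨hz0, hz⟩
  by_cases hle : ∑ j ∈ Finset.range q, (z j).natAbs ≤ T
  · exact ⟨(z, none), ⟨⟨hz0, hle⟩, trivial⟩, rfl⟩
  · have hne : ∃ i ∈ Finset.range q, (z i).natAbs ≠ 0 := by
      by_contra! h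
      rw [Finset.sum_eq_zero h] at hle
      omega
    obtain ⟨i, hi, hzi⟩ := hne
    have hiq := Finset.mem_range.1 hi
    refine ⟨(Function.update z i (z i - if 0 < z i then 1 else -1),
      some (⟨i, hiq⟩, decide (0 < z i))), ⟨⟨?_, ?_⟩, trivial⟩, ?_⟩
    · intro j hj
      simp only
      rw [Function.update_of_ne (by omega)]
      exact hz0 j hj
    · simp only
      rw [← Finset.add_sum_erase _ _ hi] at hz ⊢
      rw [Function.update_self]
      have h1 : ∑ j ∈ (Finset.range q).erase i,
          (Function.update z i (z i - if 0 < z i then 1 else -1) j).natAbs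
          = ∑ j ∈ (Finset.range q).erase i, (z j).natAbs :=
        Finset.sum_congr rfl fun j hj => by
          rw [Function.update_of_ne (Finset.ne_of_mem_erase hj)]
      rw [h1]
      split_ifs <;> omega
    · simp

lemma boundedVectors_finite_ncard_le (q T : ℕ) :
    (boundedVectors q T).Finite ∧ (boundedVectors q T).ncard ≤ (2 * q + 1) ^ T := by
  induction T with
  | zero =>
    have : boundedVectors q 0 ⊆ {fun _ => 0} := by
      rintro z ⟨hz0, hz⟩
      simp only [nonpos_iff_eq_zero, Finset.sum_eq_zero_iff, Finset.mem_range,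
        Int.natAbs_eq_zero] at hz
      funext j
      by_cases hj : j < q
      · exact hz j hj
      · exact hz0 j (by omega)
    exact ⟨(Set.finite_singleton _).subset this,
      (Set.ncard_le_ncard this).trans (by simp)⟩
  | succ T ih =>
    have hfin : (boundedVectors q T ×ˢ (Set.univ : Set (Option (Fin q × Bool)))).Finite :=
      ih.1.prod Set.finite_univ
    refine ⟨(hfin.image _).subset (boundedVectors_succ_subset q T), ?_⟩
    refine (Set.ncard_le_ncard (boundedVectors_succ_subset q T) (hfin.image _)).trans ?_
    refine (Set.ncard_image_le hfin).trans ?_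
    rw [Set.ncard_prod, Set.ncard_univ, Nat.card_eq_fintype_card, pow_succ]
    simp only [Fintype.card_option, Fintype.card_prod, Fintype.card_fin, Fintype.card_bool]
    rw [mul_comm q 2]
    exact Nat.mul_le_mul_right _ ih.2

end BoundedVectors

/-! ### Simulation of a statistical query algorithm from the stored multiples. -/

section Simulation

variable {X : Type u} [MeasurableSpace X] {F : Type v}

/-- The result of an algorithm whose queries are answered by `ans`. -/
def SQAlgorithm.resultWith (ans : StatQuery X → ℝ) : SQAlgorithm X F → F
  | .output f => f
  | .query φ next => (next (ans φ)).resultWith ans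

/-- Branches of the inductive type are finite, so legal answers always lead to an output. `Solves`
only constrains outcomes; this provides one. -/
lemma SQAlgorithm.exists_outcome_resultWith {D : ProbabilityMeasure X} {τ : ℝ}
    {ans : StatQuery X → ℝ} (hans : ∀ φ, |ans φ - φ.mean D| ≤ τ) (A : SQAlgorithm X F) :
    ∃ k, SQAlgorithm.Outcome D τ A k (A.resultWith ans) := by
  induction A with
  | output f => exact ⟨0, .output f⟩
  | query φ next ih =>
    obtain ⟨k, hk⟩ := ih (ans φ)
    exact ⟨k + 1, .query φ next _ k _ (hans φ) hk⟩

/-- The query asked next, or the zero query if the algorithm has stopped. -/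
def SQAlgorithm.currentQuery : SQAlgorithm X F → StatQuery X
  | .output _ => ⟨fun _ => 0, measurable_const, fun _ => by simp⟩
  | .query φ _ => φ

/-- One query is simulated: the multiple `τ / 6 * w` of it is added to the exponent, and it is
answered by its mean under the tilted measure. -/
noncomputable def SQAlgorithm.advance (P : Measure X) (τ : ℝ) (w : ℤ) :
    SQAlgorithm X F × (X → ℝ) → SQAlgorithm X F × (X → ℝ)
  | (.output f, W) => (.output f, W)
  | (.query φ next, W) =>
    (next (∫ x, φ.toFun x ∂(P.tilted fun x => W x + τ / 6 * w * φ.toFun x)),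
      fun x => W x + τ / 6 * w * φ.toFun x)

/-- The simulation of the first queries of `A`, the `i`-th of which uses the multiple `z i`. -/
noncomputable def SQAlgorithm.replay (P : Measure X) (τ : ℝ) (A : SQAlgorithm X F) (z : ℕ → ℤ) :
    ℕ → SQAlgorithm X F × (X → ℝ)
  | 0 => (A, fun _ => 0)
  | i + 1 => SQAlgorithm.advance P τ (z i) (SQAlgorithm.replay P τ A z i)

/-- Recording the multiple of query `i` leaves the replay of the queries before it unchanged. -/
lemma SQAlgorithm.replay_congr (P : Measure X) (τ : ℝ) (A : SQAlgorithm X F) {z z' : ℕ → ℤ}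
    {i : ℕ} (h : ∀ j < i, z j = z' j) : A.replay P τ z i = A.replay P τ z' i := by
  induction i with
  | zero => rfl
  | succ i ih =>
    simp only [SQAlgorithm.replay]
    rw [ih fun j hj => h j (by omega), h i (by omega)]

/-- The state `s` of a simulation is correct for `D` after `i` queries, of which at most `q` may be
asked, and after additions to the exponent of total size `n`. -/
def SQAlgorithm.Correct (P : Measure X) (τ : ℝ) (q : ℕ) (V : Set F) (D : ProbabilityMeasure X)
    (i n : ℕ) (s : SQAlgorithm X F × (X → ℝ)) : Prop :=
  BddMeasurable s.2 ∧ τ ^ 2 / 36 * n ≤ donskerVaradhan D P s.2 ∧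
    ((∃ f ∈ V, s.1 = .output f) ∨
      ∀ k f, SQAlgorithm.Outcome D τ s.1 k f → k + i ≤ q ∧ f ∈ V)

/-- The order of quantifiers is the point: `w` depends on the simulated state and the estimate `p`
only, so the machine can choose it without knowing `D`. -/
lemma SQAlgorithm.exists_correct_advance (P : Measure X) [IsProbabilityMeasure P] {τ : ℝ}
    (h0 : 0 < τ) (h1 : τ ≤ 1) (s : SQAlgorithm X F × (X → ℝ)) (p : ℝ) :
    ∃ w : ℤ, ∀ (q : ℕ) (V : Set F) (D : ProbabilityMeasure X) (i n : ℕ),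
      InformationTheory.klDiv (D : Measure X) P ≠ ⊤ → |p - s.1.currentQuery.mean D| ≤ τ / 3 →
      SQAlgorithm.Correct P τ q V D i n s →
      SQAlgorithm.Correct P τ q V D (i + 1) (n + w.natAbs) (SQAlgorithm.advance P τ w s) := by
  obtain ⟨A, W⟩ := s
  cases A with
  | output f =>
    refine ⟨0, fun q V D i n _ _ ⟨hW, hn, hV⟩ => ⟨hW, by simpa [SQAlgorithm.advance] using hn,
      Or.inl ⟨f, ?_, rfl⟩⟩⟩
    rcases hV with ⟨f', hf', heq⟩ | hV
    · cases heq; exact hf'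
    · exact (hV 0 f (.output f)).2
  | query φ next =>
    by_cases hex : BddMeasurable W ∧ ∃ D : ProbabilityMeasure X,
        InformationTheory.klDiv (D : Measure X) P ≠ ⊤ ∧ |p - φ.mean D| ≤ τ / 3
    · obtain ⟨w, hclose, hgain⟩ := exists_int_tilted_mean_close P hex.1 φ h0 h1 p hex.2
      refine ⟨w, fun q V D i n _ hp ⟨hW, hn, hV⟩ =>
        ⟨hW.add_const_mul φ.bddMeasurable _, ?_, Or.inr fun k f hk => ?_⟩⟩
      · have h2 := hgain D hp
        simp only [SQAlgorithm.advance] at hn ⊢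
        push_cast
        rw [Nat.cast_natAbs, Int.cast_abs]
        linarith
      · rcases hV with ⟨f', _, heq⟩ | hV
        · cases heq
        · have hv : |∫ x, φ.toFun x ∂(P.tilted fun x => W x + τ / 6 * w * φ.toFun x)
              - φ.mean D| ≤ τ := by
            refine (abs_sub_le _ p _).trans ?_
            have : |p - φ.mean D| ≤ τ / 3 := hp
            linarith
          have := hV (k + 1) f (.query φ next _ k f hv hk)
          exact ⟨by omega, this.2⟩
    -- No distribution meets the hypotheses here, so `0` is an arbitrary value.
    · exact ⟨0, fun q V D i n hkl hp hc => absurd ⟨hc.1, D, hkl, hp⟩ hex⟩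

/-- The budget is spent: if a query were still pending, continuing with the true means would give an
outcome with more than `q` queries in total. -/
lemma SQAlgorithm.Correct.exists_eq_output {P : Measure X} {τ : ℝ} (h0 : 0 ≤ τ) {q n : ℕ}
    {V : Set F} {D : ProbabilityMeasure X} {s : SQAlgorithm X F × (X → ℝ)}
    (h : SQAlgorithm.Correct P τ q V D q n s) : ∃ f ∈ V, s.1 = .output f := by
  obtain ⟨-, -, h | h⟩ := h
  · exact h
  · obtain ⟨A, W⟩ := s
    have hans : ∀ φ : StatQuery X, |φ.mean D - φ.mean D| ≤ τ := fun _ => by simpa using h0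
    cases A with
    | output f => exact ⟨f, (h 0 f (.output f)).2, rfl⟩
    | query φ next =>
      obtain ⟨k, hk⟩ := SQAlgorithm.exists_outcome_resultWith hans (next (φ.mean D))
      have := (h _ _ (.query φ next _ k _ (hans φ) hk)).1
      omega

/-- The potential lies between `τ² / 36 * n` and `K`; this is what bounds the memory. -/
lemma SQAlgorithm.Correct.le_of_klDiv_le {P : Measure X} [IsProbabilityMeasure P] {τ K : ℝ}
    (h0 : 0 < τ) {q i n T : ℕ} {V : Set F} {D : ProbabilityMeasure X}
    {s : SQAlgorithm X F × (X → ℝ)} (h : SQAlgorithm.Correct P τ q V D i n s)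
    (hkl : InformationTheory.klDiv (D : Measure X) P ≤ ENNReal.ofReal K) (hK : 0 ≤ K)
    (hT : 36 * K / τ ^ 2 < T + 1) : n ≤ T := by
  have hne : InformationTheory.klDiv (D : Measure X) P ≠ ⊤ :=
    ne_top_of_le_ne_top ENNReal.ofReal_ne_top hkl
  have h1 := donskerVaradhan_le_klDiv (D : Measure X) P hne h.1
  have h2 := ENNReal.toReal_le_of_le_ofReal hK hkl
  have h3 := h.2.1
  rw [div_lt_iff₀ (by positivity)] at hT
  have h4 : (n : ℝ) * τ ^ 2 < (T + 1) * τ ^ 2 := by linarith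
  have h5 : (n : ℝ) < T + 1 := lt_of_mul_lt_mul_right h4 (by positivity)
  exact Nat.lt_succ_iff.1 (by exact_mod_cast h5)

variable (P : Measure X) (τ : ℝ) (A : SQAlgorithm X F)

open Classical in
/-- After query number `c.1` has been simulated with the multiple `w c s`, where `s` is the sum of
the values of the query on the samples, the configuration records the multiple. -/
noncomputable def recordStep {q T : ℕ} (w : Fin (q + 1) × boundedVectors q T → ℕ → ℤ)
    (c : Fin (q + 1) × boundedVectors q T) (s : ℕ) : Fin (q + 1) × boundedVectors q T :=
  -- The `else` branch keeps the map total; it is not taken during the `q` blocks while the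
  -- estimates are accurate.
  if h : (c.1 : ℕ) < q ∧ Function.update c.2.1 c.1 (w c s) ∈ boundedVectors q T then
    (⟨c.1 + 1, by omega⟩, ⟨_, h.2⟩)
  else c

/-- A statistical query algorithm can be simulated by a streaming algorithm, from a centre `P` of
small divergence from all input distributions. -/
theorem exists_streamingAlgorithm_of_solves [IsProbabilityMeasure P] {Z : SearchProblem X F}
    {q : ℕ} (hA : A.Solves Z τ q) (h0 : 0 < τ) (h1 : τ ≤ 1) [Nonempty F] {K δ : ℝ} {T k m b : ℕ}
    (hkl : ∀ D ∈ Z.dists, InformationTheory.klDiv (D : Measure X) P ≤ ENNReal.ofReal K)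
    (hK : 0 ≤ K) (hT : 36 * K / τ ^ 2 < T + 1) (hk : 6 / τ ≤ k)
    (hδ : q * (2 * Real.exp (-((m + 1 : ℕ) * τ ^ 2 / 72))) ≤ δ)
    (hb : (q + 1) * (2 * q + 1) ^ T * ((m + 1) * (2 * k * (m + 1) + 1)) ≤ 2 ^ b) :
    ∃ S : StreamingAlgorithm X F b, S.SolvesWithProb Z (q * (m + 1)) (1 - δ) := by
  classical
  have hfin := boundedVectors_finite_ncard_le q T
  have : Finite (boundedVectors q T) := hfin.1
  let Cfg := Fin (q + 1) × boundedVectors q T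
  let _ : MeasurableSpace Cfg := ⊤
  have : MeasurableSingletonClass Cfg := ⟨fun _ => trivial⟩
  choose w hw using fun (c : Cfg) (s : ℕ) =>
    SQAlgorithm.exists_correct_advance P h0 h1 (A.replay P τ c.2.1 c.1) (estimate k (m + 1) s)
  let qry : Cfg → StatQuery X := fun c => (A.replay P τ c.2.1 c.1).1.currentQuery
  let next : Cfg → ℕ → Cfg := recordStep w
  let out : SQAlgorithm X F → F := fun B => match B with
    | .output f => f
    | .query _ _ => Classical.arbitrary F
  let c₀ : Cfg := (0, ⟨_, zero_mem_boundedVectors q T⟩)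
  have hcard : Nat.card (Cfg × Fin (m + 1) × Fin (2 * k * (m + 1) + 1)) ≤ 2 ^ b := by
    refine le_trans ?_ hb
    rw [Nat.card_prod, Nat.card_prod, Nat.card_prod]
    simp only [Nat.card_eq_fintype_card (α := Fin _), Fintype.card_fin]
    gcongr
    exact hfin.2
  obtain ⟨S, hS⟩ := exists_streamingAlgorithm_run
    (measurable_blockUpdate (m := m) (B := 2 * k * (m + 1)) (g := fun c => (qry c).quantized k)
      (next := next) fun c => (qry c).measurable_quantized k)
    (c₀, 0, 0) (fun s => out (A.replay P τ s.1.2.1 q).1) hcard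
  refine ⟨S, fun D => ?_⟩
  -- The sets depend on `D` but serve the analysis only. Unused coordinates are zero, so recording a
  -- multiple adds exactly its absolute value to the norm.
  let G : ℕ → Set Cfg := fun i => {c | (c.1 : ℕ) = i ∧ (∀ j, i ≤ j → c.2.1 j = 0) ∧
    SQAlgorithm.Correct P τ q (Z.valid D) D i (∑ j ∈ Finset.range q, (c.2.1 j).natAbs)
      (A.replay P τ c.2.1 i)}
  have hklD := hkl D D.2
  have hne : InformationTheory.klDiv ((D : ProbabilityMeasure X) : Measure X) P ≠ ⊤ :=
    ne_top_of_le_ne_top ENNReal.ofReal_ne_top hklD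
  have hG : ∀ i < q, ∀ c ∈ G i, ∀ s : ℕ, |estimate k (m + 1) s - (qry c).mean D| ≤ τ / 3 →
      next c s ∈ G (i + 1) := by
    rintro i hi c ⟨hci, hc0, hc⟩ s hs
    subst hci
    have hcorrect := hw c s q (Z.valid D) D c.1 _ hne hs hc
    have hreplay : A.replay P τ (Function.update c.2.1 c.1 (w c s)) (c.1 + 1)
        = SQAlgorithm.advance P τ (w c s) (A.replay P τ c.2.1 c.1) := by
      simp only [SQAlgorithm.replay, Function.update_self]
      rw [SQAlgorithm.replay_congr P τ A fun j hj => Function.update_of_ne (by omega) _ _]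
    have hsum : ∑ j ∈ Finset.range q, (Function.update c.2.1 c.1 (w c s) j).natAbs
        = ∑ j ∈ Finset.range q, (c.2.1 j).natAbs + (w c s).natAbs := by
      have hmem : (c.1 : ℕ) ∈ Finset.range q := Finset.mem_range.2 hi
      rw [← Finset.add_sum_erase _ _ hmem, ← Finset.add_sum_erase _ (fun j => (c.2.1 j).natAbs) hmem,
        Function.update_self, hc0 c.1 le_rfl, Int.natAbs_zero, zero_add, add_comm]
      congr 1
      exact Finset.sum_congr rfl fun j hj => by
        rw [Function.update_of_ne (Finset.ne_of_mem_erase hj)]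
    -- The potential bound keeps the updated vector among the storable ones.
    have hmem : Function.update c.2.1 c.1 (w c s) ∈ boundedVectors q T := by
      refine ⟨fun j hj => ?_, ?_⟩
      · rw [Function.update_of_ne (by omega)]
        exact hc0 j (by omega)
      · rw [hsum]
        exact hcorrect.le_of_klDiv_le h0 hklD hK hT
    have hnext : next c s = (⟨c.1 + 1, by omega⟩, ⟨_, hmem⟩) := dif_pos ⟨hi, hmem⟩
    rw [hnext]
    refine ⟨rfl, fun j hj => ?_, ?_⟩
    · simp only
      rw [Function.update_of_ne (by omega)]
      exact hc0 j (by omega)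
    · simp only
      rw [hsum, hreplay]
      exact hcorrect
  have hc₀ : c₀ ∈ G 0 := by
    refine ⟨rfl, fun _ _ => rfl, BddMeasurable.zero, ?_, Or.inr fun k f hkf => hA D k f hkf⟩
    simp only [SQAlgorithm.replay, donskerVaradhan_zero]
    simp [c₀]
  have hprob := foldProb_blockUpdate_le (m := m) (D : ProbabilityMeasure X) qry h0 hk G hG hc₀
  have hbad : ∀ x : Fin (q * (m + 1)) → X, S.run x ∉ Z.valid D →
      (Fin.foldl (q * (m + 1)) (fun s i => blockUpdate m (2 * k * (m + 1))
        (fun c => (qry c).quantized k) next s (x i)) (c₀, 0, 0)).1 ∉ G q := by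
    rintro x hx ⟨-, -, hc⟩
    obtain ⟨f, hf, heq⟩ := hc.exists_eq_output h0.le
    rw [hS] at hx
    simp only [heq, out] at hx
    exact hx hf
  have hle : (Measure.pi fun _ : Fin (q * (m + 1)) => ((D : ProbabilityMeasure X) : Measure X)).real
      {x | S.run x ∈ Z.valid D}ᶜ ≤ δ := by
    have h2 : (0 : ℝ) ≤ q * (2 * Real.exp (-((m + 1 : ℕ) * τ ^ 2 / 72))) := by positivity
    refine ENNReal.toReal_le_of_le_ofReal (h2.trans hδ) ?_
    refine (measure_mono fun x hx => hbad x hx).trans (hprob.trans ?_)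
    rw [← ENNReal.ofReal_natCast, ← ENNReal.ofReal_mul (by positivity)]
    exact ENNReal.ofReal_le_ofReal hδ
  have hcover := measureReal_union_le
    (μ := Measure.pi fun _ : Fin (q * (m + 1)) => ((D : ProbabilityMeasure X) : Measure X))
    {x | S.run x ∈ Z.valid D} {x | S.run x ∈ Z.valid D}ᶜ
  rw [Set.union_compl_self, probReal_univ] at hcover
  linarith

/-- A finite infimum in `ℕ∞` is attained. -/
lemma exists_solves_of_sqComplexity_le {Z : SearchProblem X F} {q : ℕ}
    (h : sqComplexity Z τ ≤ (q : ℕ∞)) : ∃ A : SQAlgorithm X F, A.Solves Z τ q := by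
  have hne : {c : ℕ∞ | ∃ q : ℕ, c = (q : ℕ∞) ∧ ∃ A : SQAlgorithm X F, A.Solves Z τ q}.Nonempty := by
    by_contra hempty
    rw [Set.not_nonempty_iff_eq_empty] at hempty
    rw [sqComplexity, hempty, sInf_empty] at h
    exact absurd h (by simp)
  obtain ⟨q', hq', A, hA⟩ := csInf_mem hne
  have hle : q' ≤ q := by
    have : (q' : ℕ∞) ≤ q := hq' ▸ h
    exact_mod_cast this
  exact ⟨A, fun D k f hk => ⟨(hA D k f hk).1.trans hle, (hA D k f hk).2⟩⟩

end Simulation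

/-! ### Numerical bounds on samples and bits. -/

section Parameters

/-- The number of samples of a block. -/
noncomputable def blockLength (τ δ : ℝ) (q : ℕ) : ℕ :=
  ⌈72 * Real.log (2 * q / δ) / τ ^ 2⌉₊

variable {τ δ R : ℝ} {q : ℕ}

lemma one_le_log_two_mul_div (hδ : 0 < δ) (hδ1 : δ < 1) (hq : 2 ≤ q) :
    1 ≤ Real.log (2 * q / δ) := by
  have hq' : (2 : ℝ) ≤ q := by exact_mod_cast hq
  rw [Real.le_log_iff_exp_le (by positivity), le_div_iff₀ hδ]
  have := Real.exp_one_lt_d9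
  nlinarith [Real.exp_pos 1]

lemma blockLength_pos (hτ : 0 < τ) (hδ : 0 < δ) (hδ1 : δ < 1) (hq : 2 ≤ q) :
    0 < blockLength τ δ q := by
  have := one_le_log_two_mul_div hδ hδ1 hq
  exact Nat.ceil_pos.2 (by positivity)

lemma blockLength_le (hτ : 0 < τ) (hτ1 : τ ≤ 1) (hδ : 0 < δ) (hδ1 : δ < 1) (hq : 2 ≤ q) :
    (blockLength τ δ q : ℝ) ≤ 73 * Real.log (2 * q / δ) / τ ^ 2 := by
  have h1 := one_le_log_two_mul_div hδ hδ1 hq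
  have h2 : 1 ≤ Real.log (2 * q / δ) / τ ^ 2 := by
    rw [le_div_iff₀ (by positivity)]
    nlinarith
  have h3 : (blockLength τ δ q : ℝ) < 72 * Real.log (2 * q / δ) / τ ^ 2 + 1 :=
    Nat.ceil_lt_add_one (by positivity)
  have h4 : 73 * Real.log (2 * q / δ) / τ ^ 2
      = 72 * Real.log (2 * q / δ) / τ ^ 2 + Real.log (2 * q / δ) / τ ^ 2 := by ring
  linarith

lemma mul_exp_blockLength_le (hτ : 0 < τ) (hδ : 0 < δ) (hq : 2 ≤ q) :
    q * (2 * Real.exp (-(blockLength τ δ q * τ ^ 2 / 72))) ≤ δ := by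
  have hq' : (2 : ℝ) ≤ q := by exact_mod_cast hq
  have h1 : 72 * Real.log (2 * q / δ) / τ ^ 2 ≤ blockLength τ δ q := Nat.le_ceil _
  rw [div_le_iff₀ (by positivity)] at h1
  have h2 : Real.exp (-(blockLength τ δ q * τ ^ 2 / 72)) ≤ (2 * q / δ)⁻¹ := by
    rw [← Real.exp_log (show 0 < 2 * q / δ by positivity), ← Real.exp_neg, Real.exp_le_exp]
    linarith
  calc q * (2 * Real.exp (-(blockLength τ δ q * τ ^ 2 / 72)))
      ≤ q * (2 * (2 * q / δ)⁻¹) := by gcongr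
    _ = δ := by field_simp

lemma mul_blockLength_le (hτ : 0 < τ) (hτ1 : τ ≤ 1) (hδ : 0 < δ) (hδ1 : δ < 1) (hq : 2 ≤ q)
    (hR : τ ^ 2 / 4 ≤ R) :
    ((q * blockLength τ δ q : ℕ) : ℝ) ≤ 640 * (q * R / τ ^ 4 * Real.log (q / (τ * δ))) := by
  have hq' : (2 : ℝ) ≤ q := by exact_mod_cast hq
  have hτδ : 0 < τ * δ := by positivity
  have h1 := blockLength_le hτ hτ1 hδ hδ1 hq
  -- Since `q ≥ 2`, `2q / δ ≤ (q / (τδ))²`.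
  have h2 : Real.log (2 * q / δ) ≤ 2 * Real.log (q / (τ * δ)) := by
    rw [← Real.log_rpow (by positivity), Real.rpow_two]
    refine Real.log_le_log (by positivity) ?_
    rw [div_pow, div_le_div_iff₀ hδ (by positivity)]
    have h3 : τ ^ 2 * δ ≤ 1 := by nlinarith [sq_nonneg τ]
    have h4 : 2 * q * (τ ^ 2 * δ) ≤ q * q :=
      calc 2 * q * (τ ^ 2 * δ) ≤ 2 * q * 1 := by gcongr
        _ ≤ q * q := by nlinarith
    calc 2 * q * (τ * δ) ^ 2 = 2 * q * (τ ^ 2 * δ) * δ := by ring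
      _ ≤ q * q * δ := by gcongr
      _ = q ^ 2 * δ := by ring
  have h5 : 0 ≤ Real.log (q / (τ * δ)) := by
    linarith [one_le_log_two_mul_div hδ hδ1 hq]
  -- The only place where the sample bound acquires the factor `R / τ²`: it is at least `1 / 4`.
  have h6 : 1 / τ ^ 2 ≤ 4 * (R / τ ^ 4) := by
    rw [div_le_iff₀ (by positivity)]
    have : 4 * (R / τ ^ 4) * τ ^ 2 = 4 * R / τ ^ 2 := by field_simp
    rw [this, le_div_iff₀ (by positivity)]
    linarith
  push_cast
  calc (q : ℝ) * blockLength τ δ q ≤ q * (73 * Real.log (2 * q / δ) / τ ^ 2) := by gcongr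
    _ ≤ q * (73 * (2 * Real.log (q / (τ * δ))) / τ ^ 2) := by gcongr
    _ = 146 * (q * Real.log (q / (τ * δ))) * (1 / τ ^ 2) := by ring
    _ ≤ 146 * (q * Real.log (q / (τ * δ))) * (4 * (R / τ ^ 4)) := by gcongr
    _ = 584 * (q * R / τ ^ 4 * Real.log (q / (τ * δ))) := by ring
    _ ≤ _ := by
      have hR0 : 0 ≤ R := le_trans (by positivity) hR
      gcongr
      norm_num

lemma clog_card_le (hτ : 0 < τ) (hτ1 : τ ≤ 1) (hδ : 0 < δ) (hδ1 : δ < 1) (hq : 2 ≤ q)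
    (hR : τ ^ 2 / 4 ≤ R) {T : ℕ} (hT : T ≤ 72 * R / τ ^ 2) :
    (Nat.clog 2 ((q + 1) * (2 * q + 1) ^ T *
        (blockLength τ δ q * (2 * ⌈6 / τ⌉₊ * blockLength τ δ q + 1))) : ℝ)
      ≤ 640 * (R / τ ^ 2 * Real.log q + Real.log ((1 + Real.log (1 / δ)) / τ)) := by
  set N := (q + 1) * (2 * q + 1) ^ T *
        (blockLength τ δ q * (2 * ⌈6 / τ⌉₊ * blockLength τ δ q + 1)) with hN
  set M := blockLength τ δ q with hM
  set k := ⌈6 / τ⌉₊ with hk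
  set d := 1 + Real.log (1 / δ) with hd
  have hq' : (2 : ℝ) ≤ q := by exact_mod_cast hq
  have hlogδ : 0 ≤ Real.log (1 / δ) := Real.log_nonneg (by rw [le_div_iff₀ hδ]; linarith)
  have hd1 : 1 ≤ d := by linarith
  have hM0 : 0 < M := blockLength_pos hτ hδ hδ1 hq
  have hM1 : (1 : ℝ) ≤ M := by exact_mod_cast hM0
  -- Numerical constants are absorbed into powers of `q`, so that only `log q` and `log (d / τ)`
  -- survive.
  have hpow : ∀ n : ℕ, (2 : ℝ) ^ n ≤ q ^ n := fun n => pow_le_pow_left₀ (by norm_num) hq' n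
  have hlogle : Real.log (2 * q / δ) ≤ q ^ 2 * d := by
    have h1 : Real.log (2 * q / δ) = Real.log (2 * q) + Real.log (1 / δ) := by
      rw [← Real.log_mul (by positivity) (by positivity)]; ring_nf
    have h2 := Real.log_le_sub_one_of_pos (show (0 : ℝ) < 2 * q by positivity)
    have h3 : (2 : ℝ) * q ≤ q ^ 2 := by nlinarith
    have h4 : Real.log (1 / δ) ≤ q ^ 2 * Real.log (1 / δ) :=
      le_mul_of_one_le_left hlogδ (by nlinarith)
    rw [h1, hd]; linarith
  have hMle : (M : ℝ) ≤ q ^ 9 * d / τ ^ 2 := by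
    refine (blockLength_le hτ hτ1 hδ hδ1 hq).trans ?_
    gcongr ?_ / _
    calc 73 * Real.log (2 * q / δ) ≤ 2 ^ 7 * (q ^ 2 * d) := by
          gcongr
          · exact (one_le_log_two_mul_div hδ hδ1 hq).trans' zero_le_one
          · norm_num
      _ ≤ q ^ 7 * (q ^ 2 * d) := by gcongr
      _ = q ^ 9 * d := by ring
  have hkle : (k : ℝ) ≤ 7 / τ := by
    have h1 := (Nat.ceil_lt_add_one (show 0 ≤ 6 / τ by positivity)).le
    have h2 : 1 ≤ 1 / τ := by rw [le_div_iff₀ hτ]; linarith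
    have h3 : 7 / τ = 6 / τ + 1 / τ := by ring
    linarith
  have hk1 : (1 : ℝ) ≤ k := by
    have : 0 < k := Nat.ceil_pos.2 (by positivity)
    exact_mod_cast this
  have hsum : (2 * k * M + 1 : ℝ) ≤ q ^ 14 * d / τ ^ 3 :=
    calc (2 * k * M + 1 : ℝ) ≤ 3 * (k * M) := by nlinarith
      _ ≤ 3 * (7 / τ * (q ^ 9 * d / τ ^ 2)) := by gcongr
      _ = 21 * (q ^ 9 * d / τ ^ 3) := by field_simp; ring
      _ ≤ 2 ^ 5 * (q ^ 9 * d / τ ^ 3) := by gcongr; norm_num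
      _ ≤ q ^ 5 * (q ^ 9 * d / τ ^ 3) := by gcongr
      _ = q ^ 14 * d / τ ^ 3 := by ring
  have hNle : (N : ℝ) ≤ q ^ (25 + 3 * T) * (d / τ) ^ 5 := by
    have h1 : (q + 1 : ℝ) ≤ q ^ 2 := by nlinarith
    have h2 : (2 * q + 1 : ℝ) ≤ q ^ 3 := by nlinarith [sq_nonneg ((q : ℝ) - 2)]
    rw [hN]
    push_cast
    calc ((q : ℝ) + 1) * (2 * q + 1) ^ T * (M * (2 * k * M + 1))
        ≤ q ^ 2 * (q ^ 3) ^ T * (q ^ 9 * d / τ ^ 2 * (q ^ 14 * d / τ ^ 3)) := by gcongr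
      _ = q ^ (25 + 3 * T) * (d ^ 2 * 1 / τ ^ 5) := by
        rw [← pow_mul, pow_add]; field_simp
      _ ≤ q ^ (25 + 3 * T) * (d ^ 2 * d ^ 3 / τ ^ 5) := by
        gcongr; exact one_le_pow₀ hd1
      _ = _ := by rw [div_pow]; ring
  have hN2 : 1 < N := by
    rw [hN]
    have h1 : 1 ≤ (2 * q + 1) ^ T := Nat.one_le_pow _ _ (by omega)
    have h2 : 1 ≤ M * (2 * k * M + 1) := Nat.mul_pos hM0 (by omega)
    calc 1 < (q + 1) * 1 * 1 := by omega
      _ ≤ _ := by gcongr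
  have hclog : (2 : ℝ) ^ Nat.clog 2 N ≤ 2 * N := by
    have h1 := Nat.pow_pred_clog_lt_self (b := 2) (by norm_num) hN2
    have h2 : 0 < Nat.clog 2 N := Nat.clog_pos (by norm_num) hN2
    have h3 : 2 ^ Nat.clog 2 N ≤ 2 * N := by
      rw [← Nat.succ_pred_eq_of_pos h2, pow_succ]; omega
    exact_mod_cast h3
  have hL : 0 ≤ Real.log (d / τ) := Real.log_nonneg (by rw [le_div_iff₀ hτ]; linarith)
  have hlog : Nat.clog 2 N * Real.log 2
      ≤ (26 + 3 * T) * Real.log q + 5 * Real.log (d / τ) := by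
    have h1 : (2 : ℝ) ^ Nat.clog 2 N ≤ q ^ (26 + 3 * T) * (d / τ) ^ 5 :=
      calc (2 : ℝ) ^ Nat.clog 2 N ≤ 2 * N := hclog
        _ ≤ q * (q ^ (25 + 3 * T) * (d / τ) ^ 5) := by gcongr
        _ = _ := by ring
    have h2 := Real.log_le_log (by positivity) h1
    rw [Real.log_pow, Real.log_mul (by positivity) (by positivity), Real.log_pow,
      Real.log_pow] at h2
    push_cast at h2
    exact h2
  have hlq : 0 ≤ Real.log q := Real.log_nonneg (by linarith)
  have hρ : 1 / 4 ≤ R / τ ^ 2 := by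
    rw [le_div_iff₀ (by positivity)]; linarith
  have hT' : (T : ℝ) ≤ 72 * (R / τ ^ 2) := by rw [← mul_div_assoc]; exact hT
  -- With `R / τ² ≥ 1 / 4`, the constant `26` costs `104` and `3 * T` costs `216`. Dividing by `log
  -- 2 ≥ 1 / 2` then gives `640`.
  have h3 : (26 + 3 * T) * Real.log q ≤ 320 * (R / τ ^ 2) * Real.log q := by
    gcongr; linarith
  have hlog2 := Real.log_two_gt_d9
  have h4 : (Nat.clog 2 N : ℝ) * (1 / 2) ≤ Nat.clog 2 N * Real.log 2 := by
    gcongr; linarith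
  linarith

end Parameters

/-! ### The theorem: the trivial case and the choice of parameters. -/

theorem mainTheorem12 :
    ∃ C : ℝ, 0 < C ∧
      ∀ (X : Type u) [MeasurableSpace X] (F : Type v) (Z : SearchProblem X F) (τ δ : ℝ) (q : ℕ),
        Z.dists.Finite → 0 < τ → τ ≤ 1 → 0 < δ → δ < 1 → 2 ≤ q →
        sqComplexity Z τ ≤ (q : ℕ∞) →
        ∃ (n b : ℕ) (S : StreamingAlgorithm X F b),
          S.SolvesWithProb Z n (1 - δ) ∧
          (n : ℝ) ≤ C * (q * (klRadius Z.dists).toReal / τ ^ 4 * Real.log (q / (τ * δ))) ∧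
          (b : ℝ) ≤ C * ((klRadius Z.dists).toReal / τ ^ 2 * Real.log q
            + Real.log ((1 + Real.log (1 / δ)) / τ)) := by
  refine ⟨640, by norm_num, ?_⟩
  intro X _ F Z τ δ q hfin hτ hτ1 hδ hδ1 hq hqc
  obtain ⟨A, hA⟩ := exists_solves_of_sqComplexity_le τ hqc
  have hq' : (2 : ℝ) ≤ q := by exact_mod_cast hq
  have : Nonempty F := ⟨A.resultWith fun _ => 0⟩
  -- A universally valid solution needs neither samples nor memory. This case covers an empty class
  -- and a radius too small for the potential argument to fit the bounds.
  by_cases hsmall : ∃ f, ∀ D : Z.dists, f ∈ Z.valid D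
  · obtain ⟨f, hf⟩ := hsmall
    have hn : 0 ≤ Real.log (q / (τ * δ)) := by
      refine Real.log_nonneg ?_
      rw [le_div_iff₀ (by positivity)]
      nlinarith
    have hb : 0 ≤ Real.log ((1 + Real.log (1 / δ)) / τ) := by
      have : 0 ≤ Real.log (1 / δ) := Real.log_nonneg (by rw [le_div_iff₀ hδ]; linarith)
      exact Real.log_nonneg (by rw [le_div_iff₀ hτ]; linarith)
    have hlq : 0 ≤ Real.log q := Real.log_nonneg (by linarith)
    refine ⟨0, 0, ⟨fun _ => false, fun s _ => s, fun _ => measurable_const, fun _ => f⟩,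
      fun D => ?_, ?_, ?_⟩
    · simp only [StreamingAlgorithm.run, hf D, Set.ofPred_true, probReal_univ]
      linarith
    · push_cast; positivity
    · push_cast; positivity
  · have hne : Z.dists.Nonempty := by
      by_contra hempty
      rw [Set.not_nonempty_iff_eq_empty] at hempty
      exact hsmall ⟨Classical.arbitrary F, fun D => absurd D.2 (by simp [hempty])⟩
    have htop := klRadius_ne_top hfin hne
    have hR : τ ^ 2 / 4 ≤ (klRadius Z.dists).toReal := by
      by_contra! hlt
      obtain ⟨P, hP⟩ := exists_klDiv_lt_of_klRadius_lt
        ((ENNReal.lt_ofReal_iff_toReal_lt htop).2 hlt)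
      -- The means under `P` are legal answers for all `D` simultaneously, so a single transcript
      -- serves the whole class.
      refine hsmall ⟨A.resultWith fun φ => φ.mean P, fun D => ?_⟩
      obtain ⟨k, hk⟩ := SQAlgorithm.exists_outcome_resultWith (D := D) (τ := τ)
        (ans := fun φ => φ.mean P)
        (fun φ => abs_mean_sub_le_of_klDiv_le _ _ φ hτ hτ1 (hP D D.2).le) A
      exact (hA D k _ hk).2
    set R := (klRadius Z.dists).toReal with hRdef
    have hR0 : 0 < R := lt_of_lt_of_le (by positivity) hR
    -- The infimum need not be attained; the slack `2 * R`, available as `R > 0`, turns `36` into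
    -- `72`.
    obtain ⟨P, hP⟩ := exists_klDiv_lt_of_klRadius_lt (𝒟 := Z.dists) (c := ENNReal.ofReal (2 * R))
      ((ENNReal.lt_ofReal_iff_toReal_lt htop).2 (by linarith))
    obtain ⟨m, hm⟩ := Nat.exists_eq_succ_of_ne_zero (blockLength_pos hτ hδ hδ1 hq).ne'
    have hexp := mul_exp_blockLength_le hτ hδ hq
    have hsamples := mul_blockLength_le hτ hτ1 hδ hδ1 hq hR
    have hbits := clog_card_le hτ hτ1 hδ hδ1 hq hR (T := ⌊72 * R / τ ^ 2⌋₊)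
      (Nat.floor_le (by positivity))
    rw [hm] at hexp hsamples hbits
    obtain ⟨S, hS⟩ := exists_streamingAlgorithm_of_solves (P : Measure X) τ A hA hτ hτ1
      (T := ⌊72 * R / τ ^ 2⌋₊) (fun D hD => (hP D hD).le) (by positivity)
      (by
        rw [← mul_assoc, show (36 * 2 : ℝ) = 72 by norm_num]
        exact Nat.lt_floor_add_one _)
      (Nat.le_ceil _) hexp (Nat.le_pow_clog (by norm_num) _)
    exact ⟨_, _, S, hS, hsamples, hbits⟩
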